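/- Let $n\ge 2$ be an integer, let $0<\alpha\le\infty$ and let $I=[0,\alpha)$. For $f\colon I\to\mathbb R$ and a self-adjoint matrix $A\in M_k(\mathbb C)$ with all eigenvalues in $I$, let $f(A)$ be defined by the functional calculus, and order self-adjoint matrices by $A\le B$ if $B-A$ is positive semidefinite. A function $f\colon I\to\mathbb R$ is called $k$-monotone on $I$ if $A\le B$ implies $f(A)\le f(B)$, and $k$-convex on $I$ if $f(\lambda A+(1-\lambda)B)\le\lambda f(A)+(1-\lambda)f(B)$ for all $\lambda\in[0,1]$, in both cases for all self-adjoint $A,B\in M_k(\mathbb C)$ with all eigenvalues in $I$. Let $Q_n(I)$ be the class of all real $C^1$ functions $f$ on $I$ (with one-sided derivative at $0$) such that for all $\lambda_1,\dots,\lambda_n\in I$ the Loewner matrix $([\lambda_i,\lambda_j]_f)_{i,j=1}^n$, where $[s,t]_f=\frac{f(s)-f(t)}{s-t}$ for $s\ne t$ and $[t,t]_f=f'(t)$, is conditionally positive definite, that is, $\sum_{i,j}[\lambda_i,\lambda_j]_f\,\overline{x_i}x_j\ge 0$ for all $x\in\mathbb C^n$ with $\sum_i x_i=0$. If $f\in Q_n([0,\alpha))$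 and $f'$ is $(n-1)$-monotone on $[0,\alpha)$, then $f$ is $(n-1)$-convex on $[0,\alpha)$. -/

import Mathlib

open Matrix Set
open scoped ComplexOrder

noncomputable section

/-- The interval `[0, α)` of the real line, where `α` may be `∞`. -/
def halfOpenInterval (α : EReal) : Set ℝ :=
  {t : ℝ | 0 ≤ t ∧ (t : EReal) < α}

/-- `f` is `n`-monotone on `I`: `A ≤ B` implies `f(A) ≤ f(B)` for self-adjoint complex `n × n`
matrices with all eigenvalues in `I`. The order is the Loewner order, and `f(A)` is given by the
functional calculus (every `f` is continuous on the finite set `spectrum ℝ A`). -/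
def IsMatrixMonotoneOn (n : ℕ) (I : Set ℝ) (f : ℝ → ℝ) : Prop :=
  ∀ A B : Matrix (Fin n) (Fin n) ℂ, A.IsHermitian → B.IsHermitian →
    spectrum ℝ A ⊆ I → spectrum ℝ B ⊆ I →
    (B - A).PosSemidef → (cfc f B - cfc f A).PosSemidef

/-- `f` is `n`-convex on `I`: `f(cA + (1 - c)B) ≤ c f(A) + (1 - c) f(B)` for all `c ∈ [0, 1]` and
all self-adjoint complex `n × n` matrices with all eigenvalues in `I`. -/
def IsMatrixConvexOn (n : ℕ) (I : Set ℝ) (f : ℝ → ℝ) : Prop :=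
  ∀ A B : Matrix (Fin n) (Fin n) ℂ, A.IsHermitian → B.IsHermitian →
    spectrum ℝ A ⊆ I → spectrum ℝ B ⊆ I →
    ∀ c : ℝ, c ∈ Icc (0 : ℝ) 1 →
      ((c • cfc f A + (1 - c) • cfc f B) - cfc f (c • A + (1 - c) • B)).PosSemidef

/-- The first divided difference `[s, t]_f` of a function on `I`, with `[t, t]_f = f'(t)`; the
derivative is taken within `I`, hence one-sided at an endpoint that belongs to `I`. -/
def dividedDiff (I : Set ℝ) (f : ℝ → ℝ) (s t : ℝ) : ℝ :=
  if s = t then derivWithin f I s else (f s - f t) / (s - t)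

/-- The Loewner matrix `([λ_i, λ_j]_f)`. -/
def loewnerMatrix {n : ℕ} (I : Set ℝ) (f : ℝ → ℝ) (l : Fin n → ℝ) :
    Matrix (Fin n) (Fin n) ℂ :=
  Matrix.of fun i j => ((dividedDiff I f (l i) (l j) : ℝ) : ℂ)

/-- A Hermitian matrix is conditionally positive definite (almost positive) if its quadratic form
is nonnegative on all complex vectors whose coordinates sum to `0`. -/
def IsConditionallyPosDef {n : ℕ} (A : Matrix (Fin n) (Fin n) ℂ) : Prop :=
  A.IsHermitian ∧
    ∀ x : Fin n → ℂ, ∑ i, x i = 0 → 0 ≤ (star x ⬝ᵥ (A *ᵥ x)).re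

/-- The class `Q_n(I)`: real `C¹` functions on `I` all of whose `n × n` Loewner matrices at points
of `I` (not necessarily distinct) are conditionally positive definite. -/
def classQ (n : ℕ) (I : Set ℝ) : Set (ℝ → ℝ) :=
  {f | ContDiffOn ℝ 1 f I ∧
    ∀ l : Fin n → ℝ, (∀ i, l i ∈ I) → IsConditionallyPosDef (loewnerMatrix I f l)}

end

/-!
Write `[s, t, x]_f` for the second divided difference. A differentiable function is matrix convex
as soon as it lies above its tangent at every Hermitian matrix. In an eigenbasis of the point of
tangency, with eigenvalues `c i`, the error of the tangent at `X` has entries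
`cfc (fun x => f x - f (c i) - [c i, c j]_f * (x - c i)) X i j`, and the Schur product theorem
shows that it is positive semidefinite if the matrix of these scalar errors is so at each eigenvalue
`x` of `X`. Up to congruence, that matrix is `S x = ([c i, c j, x]_f)`.

The matrix `S x` increases with `x`, starting from a positive semidefinite matrix at `x = 0`:

* At `x = 0` it is the Loewner matrix of `(f t - f 0) / t = ∫ s in 0..1, f' (s * t)`, which is
  matrix monotone as an average of dilations of `f'`.
* Away from the nodes its derivative is congruent to the compression of the Loewner matrix at the
  points `c i`, `x` to the vectors with coordinate sum zero, which is positive since `f ∈ Q_n`.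
* At a node `p`, where `f` need not be twice differentiable, `S` may be discontinuous, but it jumps
  by a multiple of a rank one projection with the sign of `f (p + h) - f (p - h) - 2 * h * f' p`.
  This is nonnegative because `f ∈ Q_2` gives `2 * [s, t]_f ≤ f' s + f' t`.
-/

open Filter Topology

lemma tendsto_const_add_nhdsGT (p : ℝ) : Tendsto (fun h => p + h) (𝓝[>] 0) (𝓝[>] p) := by
  refine tendsto_nhdsWithin_iff.2 ⟨?_, ?_⟩
  · exact ((continuous_const_add p).tendsto' 0 p (add_zero p)).mono_left nhdsWithin_le_nhds
  · filter_upwards [self_mem_nhdsWithin] with h hh using lt_add_of_pos_right p hh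

lemma tendsto_const_sub_nhdsLT (p : ℝ) : Tendsto (fun h => p - h) (𝓝[>] 0) (𝓝[<] p) := by
  refine tendsto_nhdsWithin_iff.2 ⟨?_, ?_⟩
  · exact ((continuous_sub_left p).tendsto' 0 p (sub_zero p)).mono_left nhdsWithin_le_nhds
  · filter_upwards [self_mem_nhdsWithin] with h hh using sub_lt_self p hh

lemma monotoneOn_diff_singleton_of_jump_nonneg {s : Set ℝ} {p : ℝ} {G : ℝ → ℝ}
    (hlt : MonotoneOn G (s ∩ Iio p)) (hgt : MonotoneOn G (s ∩ Ioi p))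
    (hjump : ∀ x ∈ s, ∀ y ∈ s, p ∈ Ioo x y →
      s ∈ 𝓝[≠] p ∧ ∀ ε > 0, ∀ᶠ h in 𝓝[>] (0 : ℝ), G (p - h) ≤ G (p + h) + ε) :
    MonotoneOn G (s \ {p}) := by
  rintro x ⟨hxs, hxp⟩ y ⟨hys, hyp⟩ hxy
  rcases lt_or_gt_of_ne hyp with hyp | hpy
  · exact hlt ⟨hxs, hxy.trans_lt hyp⟩ ⟨hys, hyp⟩ hxy
  rcases lt_or_gt_of_ne hxp with hxp | hpx
  swap
  · exact hgt ⟨hxs, hpx⟩ ⟨hys, hpy⟩ hxy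
  obtain ⟨hsp, hjump⟩ := hjump x hxs y hys ⟨hxp, hpy⟩
  have hright : s ∩ Ioc p y ∈ 𝓝[>] p :=
    inter_mem (nhdsWithin_mono p (fun _ h => ne_of_gt h) hsp) (Ioc_mem_nhdsGT hpy)
  have hleft : s ∩ Ico x p ∈ 𝓝[<] p :=
    inter_mem (nhdsWithin_mono p (fun _ h => ne_of_lt h) hsp) (Ico_mem_nhdsLT hxp)
  refine le_of_forall_pos_le_add fun ε hε => ?_
  obtain ⟨h, hj, hr, hl⟩ := ((hjump ε hε).and
    (((tendsto_const_add_nhdsGT p).eventually_mem hright).and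
      ((tendsto_const_sub_nhdsLT p).eventually_mem hleft))).exists
  calc G x ≤ G (p - h) := hlt ⟨hxs, hxp⟩ ⟨hl.1, hl.2.2⟩ hl.2.1
    _ ≤ G (p + h) + ε := hj
    _ ≤ G y + ε := by gcongr; exact hgt ⟨hr.1, hr.2.1⟩ ⟨hys, hpy⟩ hr.2.2

lemma monotoneOn_diff_finset_of_deriv_nonneg {s : Set ℝ} (hs : Convex ℝ s) {F : Finset ℝ}
    {G G' : ℝ → ℝ} (hcont : ContinuousOn G (s \ F))
    (hderiv : ∀ x ∈ interior s \ F, HasDerivAt G (G' x) x)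
    (hnonneg : ∀ x ∈ interior s \ F, 0 ≤ G' x)
    (hjump : ∀ p ∈ F, p ∈ interior s →
      ∀ ε > 0, ∀ᶠ h in 𝓝[>] (0 : ℝ), G (p - h) ≤ G (p + h) + ε) :
    MonotoneOn G (s \ F) := by
  induction F using Finset.induction_on generalizing s with
  | empty =>
    simp only [Finset.coe_empty, sdiff_empty] at hcont hderiv hnonneg ⊢
    exact monotoneOn_of_hasDerivWithinAt_nonneg hs hcont
      (fun x hx => (hderiv x hx).hasDerivWithinAt) hnonneg
  | insert p F hpF ih =>
    have hside : ∀ U : Set ℝ, IsOpen U → Convex ℝ U → p ∉ U → MonotoneOn G ((s \ F) ∩ U) := by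
      intro U hU hUc hpU
      have hsub : ∀ {t : Set ℝ}, (t ∩ U) \ F ⊆ t \ (insert p F : Finset ℝ) := by
        rintro t x ⟨⟨hxt, hxU⟩, hxF⟩
        refine ⟨hxt, ?_⟩
        rw [Finset.coe_insert, mem_insert_iff, not_or]
        exact ⟨fun h => hpU (h ▸ hxU), hxF⟩
      have hint : interior (s ∩ U) = interior s ∩ U := by rw [interior_inter, hU.interior_eq]
      rw [inter_comm, ← inter_sdiff_assoc, inter_comm U]
      refine ih (hs.inter hUc) (hcont.mono hsub) (fun x hx => hderiv x (hsub (hint ▸ hx)))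
        (fun x hx => hnonneg x (hsub (hint ▸ hx))) fun q hq hqs => ?_
      exact hjump q (Finset.mem_insert_of_mem hq) (interior_mono inter_subset_left hqs)
    have hstraddle : ∀ x ∈ s \ F, ∀ y ∈ s \ F, p ∈ Ioo x y → s \ F ∈ 𝓝[≠] p ∧
        ∀ ε > 0, ∀ᶠ h in 𝓝[>] (0 : ℝ), G (p - h) ≤ G (p + h) + ε := by
      intro x hx y hy hp
      have hsp : s ∈ 𝓝 p :=
        mem_of_superset (Icc_mem_nhds hp.1 hp.2) (hs.ordConnected.out hx.1 hy.1)
      refine ⟨mem_nhdsWithin_of_mem_nhds ?_,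
        hjump p (Finset.mem_insert_self p F) (mem_interior_iff_mem_nhds.2 hsp)⟩
      exact inter_mem hsp (F.finite_toSet.isClosed.isOpen_compl.mem_nhds hpF)
    rw [Finset.coe_insert, ← union_singleton, ← sdiff_sdiff]
    exact monotoneOn_diff_singleton_of_jump_nonneg
      (hside _ isOpen_Iio (convex_Iio p) self_notMem_Iio)
      (hside _ isOpen_Ioi (convex_Ioi p) self_notMem_Ioi) hstraddle

/-- The quotient `φ s / s` is increasing and tends to `φ' 0` at `0`. -/
lemma mul_deriv_zero_le_of_le_mul_deriv {φ φ' : ℝ → ℝ} {h : ℝ} (hh : 0 < h) (h0 : φ 0 = 0)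
    (hφ : ∀ s ∈ Icc 0 h, HasDerivAt φ (φ' s) s) (hle : ∀ s ∈ Ioo 0 h, φ s ≤ s * φ' s) :
    h * φ' 0 ≤ φ h := by
  have hderiv : ∀ s ∈ Ioc 0 h, HasDerivAt (fun s => φ s / s) ((φ' s * s - φ s) / s ^ 2) s := by
    intro s hs
    simpa using! (hφ s ⟨hs.1.le, hs.2⟩).div (hasDerivAt_id s) hs.1.ne'
  have hmono : MonotoneOn (fun s => φ s / s) (Ioc 0 h) := by
    refine monotoneOn_of_hasDerivWithinAt_nonneg (convex_Ioc 0 h)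
      (fun s hs => (hderiv s hs).continuousAt.continuousWithinAt)
      (fun s hs => (hderiv s (interior_subset hs)).hasDerivWithinAt) fun s hs => ?_
    rw [interior_Ioc] at hs
    exact div_nonneg (by linarith [hle s hs]) (sq_nonneg s)
  have hlim : Tendsto (fun s => φ s / s) (𝓝[>] 0) (𝓝 (φ' 0)) := by
    have := (hφ 0 ⟨le_rfl, hh.le⟩).tendsto_slope_zero_right
    simpa only [zero_add, h0, sub_zero, smul_eq_mul, ← div_eq_inv_mul] using this
  rw [mul_comm, ← le_div_iff₀ hh]
  refine le_of_tendsto hlim ?_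
  filter_upwards [Ioc_mem_nhdsGT hh] with s hs using hmono hs ⟨hh, le_rfl⟩ hs.2

section HalfOpenInterval

variable {α : EReal} {s t : ℝ}

lemma halfOpenInterval_mem_nhds (ht : t ∈ halfOpenInterval α) (h0 : 0 < t) :
    halfOpenInterval α ∈ 𝓝 t := by
  filter_upwards [lt_mem_nhds h0,
    (continuous_coe_real_ereal.tendsto t).eventually (gt_mem_nhds ht.2)] with s hs hs'
    using ⟨hs.le, hs'⟩

lemma mem_halfOpenInterval_of_le (ht : t ∈ halfOpenInterval α) (h0 : 0 ≤ s) (hst : s ≤ t) :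
    s ∈ halfOpenInterval α :=
  ⟨h0, (EReal.coe_le_coe_iff.2 hst).trans_lt ht.2⟩

lemma convex_halfOpenInterval (α : EReal) : Convex ℝ (halfOpenInterval α) :=
  OrdConnected.convex
    ⟨fun _ hx _ hy _ hz => mem_halfOpenInterval_of_le hy (hx.1.trans hz.1) hz.2⟩

lemma halfOpenInterval_mem_nhdsGT (ht : t ∈ halfOpenInterval α) : halfOpenInterval α ∈ 𝓝[>] t := by
  filter_upwards [self_mem_nhdsWithin, ((continuous_coe_real_ereal.tendsto t).eventually
    (gt_mem_nhds ht.2)).filter_mono nhdsWithin_le_nhds] with s hs hs'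
    using ⟨ht.1.trans (le_of_lt hs), hs'⟩

lemma tendsto_const_add_nhdsWithin_halfOpenInterval {t : ℝ} (ht : t ∈ halfOpenInterval α) :
    Tendsto (fun e => t + e) (𝓝[>] 0) (𝓝[halfOpenInterval α] t) :=
  (tendsto_const_add_nhdsGT t).mono_right (nhdsWithin_le_of_mem (halfOpenInterval_mem_nhdsGT ht))

lemma uniqueDiffOn_halfOpenInterval (hα : 0 < α) : UniqueDiffOn ℝ (halfOpenInterval α) := by
  have h0 : (0 : ℝ) ∈ halfOpenInterval α := ⟨le_rfl, by simpa using hα⟩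
  obtain ⟨e, he, he0⟩ :=
    Filter.nonempty_of_mem (inter_mem (halfOpenInterval_mem_nhdsGT h0) self_mem_nhdsWithin)
  exact uniqueDiffOn_convex (convex_halfOpenInterval α)
    ⟨e, mem_interior_iff_mem_nhds.2 (halfOpenInterval_mem_nhds he he0)⟩

end HalfOpenInterval

section DividedDifferences

variable (I : Set ℝ) (f : ℝ → ℝ) (s t x : ℝ)

lemma dividedDiff_self : dividedDiff I f s s = derivWithin f I s := if_pos rfl

variable {s t} in
lemma dividedDiff_of_ne (h : s ≠ t) : dividedDiff I f s t = dslope f s t := by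
  rw [dividedDiff, if_neg h, dslope_of_ne _ h.symm, slope_def_field, ← neg_sub (f t), ← neg_sub t,
    neg_div_neg_eq]

lemma dividedDiff_comm : dividedDiff I f s t = dividedDiff I f t s := by
  by_cases h : s = t
  · rw [h]
  · rw [dividedDiff_of_ne I f h, dividedDiff_of_ne I f (Ne.symm h), dslope_of_ne _ (Ne.symm h),
      dslope_of_ne _ h, slope_comm]

lemma dividedDiff_mul_sub : dividedDiff I f s t * (t - s) = f t - f s := by
  by_cases h : s = t
  · rw [h, sub_self, sub_self, mul_zero]
  · rw [dividedDiff_of_ne I f h, mul_comm, ← smul_eq_mul, sub_smul_dslope]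

/-- The error at `x` of the linear interpolation of `f` at the nodes `s` and `t`; for `s = t` the
interpolant is the tangent at `s`. -/
noncomputable def interpolationError : ℝ := f x - f s - dividedDiff I f s t * (x - s)

/-- The second divided difference `[s, t, x]_f`. The nodes `s` and `t` may coincide, but the
definition is meaningful only for `x` different from both. -/
noncomputable def secondDividedDiff : ℝ := interpolationError I f s t x / ((x - s) * (x - t))

/-- The matrix `([c i, c j, x]_f)` of second divided differences. Like `secondDividedDiff`, it is
meaningful only for `x` different from all `c i`. -/
noncomputable def secondDividedDiffMatrix {ι : Type*} (c : ι → ℝ) (x : ℝ) : Matrix ι ι ℝ :=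
  of fun i j => secondDividedDiff I f (c i) (c j) x

lemma interpolationError_comm :
    interpolationError I f s t x = interpolationError I f t s x := by
  unfold interpolationError
  rw [dividedDiff_comm I f t s]
  linarith [dividedDiff_mul_sub I f s t]

lemma secondDividedDiff_comm : secondDividedDiff I f s t x = secondDividedDiff I f t s x := by
  rw [secondDividedDiff, secondDividedDiff, interpolationError_comm, mul_comm (x - s)]

variable {s t x}

lemma interpolationError_eq_mul_secondDividedDiff (hs : x ≠ s) (ht : x ≠ t) :
    interpolationError I f s t x = (x - s) * secondDividedDiff I f s t x * (x - t) := by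
  have := sub_ne_zero.2 hs
  have := sub_ne_zero.2 ht
  rw [secondDividedDiff]
  field_simp

variable (t) in
lemma secondDividedDiff_eq_dslope_sub_div (hs : x ≠ s) :
    secondDividedDiff I f s t x = (dslope f s x - dividedDiff I f s t) / (x - t) := by
  rw [secondDividedDiff, interpolationError, ← sub_smul_dslope, smul_eq_mul,
    mul_comm (dividedDiff ..), ← mul_sub, mul_div_mul_left _ _ (sub_ne_zero.2 hs)]

variable {I f}

lemma hasDerivAt_secondDividedDiff (hf : HasDerivAt f (derivWithin f I x) x)
    (hs : x ≠ s) (ht : x ≠ t) :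
    HasDerivAt (secondDividedDiff I f s t)
      ((dividedDiff I f s t - dividedDiff I f s x - dividedDiff I f x t + dividedDiff I f x x)
        / ((x - s) * (x - t))) x := by
  have hs' := sub_ne_zero.2 hs
  have ht' := sub_ne_zero.2 ht
  have hnum : HasDerivAt (interpolationError I f s t)
      (derivWithin f I x - dividedDiff I f s t * 1) x :=
    (hf.sub_const (f s)).sub (((hasDerivAt_id x).sub_const s).const_mul _)
  have hden : HasDerivAt (fun x => (x - s) * (x - t)) (1 * (x - t) + (x - s) * 1) x :=
    ((hasDerivAt_id x).sub_const s).mul ((hasDerivAt_id x).sub_const t)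
  refine (hnum.div hden (mul_ne_zero hs' ht')).congr_deriv ?_
  rw [dividedDiff_self, dividedDiff_comm I f x t]
  have errorS : interpolationError I f s t x
      = (x - s) * (dividedDiff I f s x - dividedDiff I f s t) := by
    rw [interpolationError, ← dividedDiff_mul_sub I f s x]; ring
  have errorT : interpolationError I f s t x
      = (x - t) * (dividedDiff I f t x - dividedDiff I f s t) := by
    rw [interpolationError_comm, interpolationError, ← dividedDiff_mul_sub I f t x,
      dividedDiff_comm I f t s]
    ring
  rw [div_eq_div_iff (pow_ne_zero 2 (mul_ne_zero hs' ht')) (mul_ne_zero hs' ht')]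
  linear_combination (-(x - s) ^ 2 * (x - t)) * errorT - (x - s) * (x - t) ^ 2 * errorS

lemma tendsto_secondDividedDiff {p : ℝ} (hf : DifferentiableAt ℝ f p) (ht : p ≠ t) :
    Tendsto (secondDividedDiff I f s t) (𝓝[≠] p)
      (𝓝 ((dslope f s p - dividedDiff I f s t) / (p - t))) := by
  have hslope : ContinuousAt (dslope f s) p := by
    rcases eq_or_ne p s with rfl | hps
    · exact continuousAt_dslope_same.2 hf
    · exact (continuousAt_dslope_of_ne hps).2 hf.continuousAt
  have hne : ∀ᶠ x in 𝓝[≠] p, x ≠ s := by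
    rcases eq_or_ne p s with rfl | hps
    · exact self_mem_nhdsWithin
    · exact (eventually_ne_nhds hps).filter_mono nhdsWithin_le_nhds
  have hquot : ContinuousAt (fun x => (dslope f s x - dividedDiff I f s t) / (x - t)) p :=
    (hslope.sub continuousAt_const).div (continuousAt_id.sub continuousAt_const) (sub_ne_zero.2 ht)
  refine (hquot.tendsto.mono_left nhdsWithin_le_nhds).congr' ?_
  filter_upwards [hne] with x hx using (secondDividedDiff_eq_dslope_sub_div I f t hx).symm

lemma tendsto_secondDividedDiff_add_sub {p : ℝ} (hf : DifferentiableAt ℝ f p)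
    (hst : p ≠ s ∨ p ≠ t) :
    Tendsto (fun h => secondDividedDiff I f s t (p + h) - secondDividedDiff I f s t (p - h))
      (𝓝[>] 0) (𝓝 0) := by
  obtain ⟨L, hL⟩ : ∃ L, Tendsto (secondDividedDiff I f s t) (𝓝[≠] p) (𝓝 L) := by
    rcases hst with hs | ht
    · simp only [funext (secondDividedDiff_comm I f s t)]
      exact ⟨_, tendsto_secondDividedDiff hf hs⟩
    · exact ⟨_, tendsto_secondDividedDiff hf ht⟩
  have hright : Tendsto (fun h => p + h) (𝓝[>] 0) (𝓝[≠] p) :=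
    (tendsto_const_add_nhdsGT p).mono_right (nhdsWithin_mono p fun _ h => ne_of_gt h)
  have hleft : Tendsto (fun h => p - h) (𝓝[>] 0) (𝓝[≠] p) :=
    (tendsto_const_sub_nhdsLT p).mono_right (nhdsWithin_mono p fun _ h => ne_of_lt h)
  simpa only [sub_self] using! (hL.comp hright).sub (hL.comp hleft)

lemma secondDividedDiff_same_add_sub (p : ℝ) {h : ℝ} (hh : h ≠ 0) :
    secondDividedDiff I f p p (p + h) - secondDividedDiff I f p p (p - h)
      = (f (p + h) - f (p - h) - 2 * h * derivWithin f I p) / h ^ 2 := by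
  rw [secondDividedDiff, secondDividedDiff, interpolationError, interpolationError,
    dividedDiff_self, add_sub_cancel_left, sub_sub_cancel_left]
  field_simp
  ring

end DividedDifferences

section PosSemidef

variable {ι : Type*} [Finite ι]

open scoped MatrixOrder in
lemma posSemidef_map_ofReal_iff {M : Matrix ι ι ℝ} :
    (M.map Complex.ofReal).PosSemidef ↔ M.PosSemidef := by
  classical
  have := Fintype.ofFinite ι
  refine ⟨fun h => ?_, fun h => ?_⟩
  · refine PosSemidef.of_dotProduct_mulVec_nonneg ?_ fun v => ?_
    · ext i j
      simpa using congrFun (congrFun h.isHermitian i) j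
    · have := h.dotProduct_mulVec_nonneg (Complex.ofReal ∘ v)
      have hform : star (Complex.ofReal ∘ v) ⬝ᵥ (M.map Complex.ofReal *ᵥ (Complex.ofReal ∘ v))
          = ((star v ⬝ᵥ M *ᵥ v : ℝ) : ℂ) := by
        simp [dotProduct, mulVec]
      rwa [hform, Complex.zero_le_real] at this
  · obtain ⟨B, rfl⟩ := CStarAlgebra.nonneg_iff_eq_star_mul_self.1 h.nonneg
    have hB : (star B * B).map Complex.ofReal = (B.map Complex.ofReal)ᴴ * B.map Complex.ofReal := by
      ext i j
      simp [Matrix.mul_apply, star_eq_conjTranspose]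
    rw [hB]
    exact posSemidef_conjTranspose_mul_self _

lemma posSemidef_of_tendsto {𝕜 β : Type*} [RCLike 𝕜] {l : Filter β} [l.NeBot]
    {M : β → Matrix ι ι 𝕜} {N : Matrix ι ι 𝕜} (hM : ∀ᶠ e in l, (M e).PosSemidef)
    (hlim : ∀ i j, Tendsto (fun e => M e i j) l (𝓝 (N i j))) : N.PosSemidef := by
  have := Fintype.ofFinite ι
  have hlim' : Tendsto M l (𝓝 N) := tendsto_pi_nhds.2 fun i => tendsto_pi_nhds.2 (hlim i)
  refine PosSemidef.of_dotProduct_mulVec_nonneg ?_ fun v => ?_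
  · refine tendsto_nhds_unique_of_eventuallyEq
      ((continuous_id.matrix_conjTranspose.tendsto N).comp hlim') hlim' ?_
    filter_upwards [hM] with e he using he.isHermitian
  · have hform : Continuous fun M : Matrix ι ι 𝕜 => star v ⬝ᵥ M *ᵥ v :=
      continuous_const.dotProduct (continuous_id.matrix_mulVec continuous_const)
    refine ge_of_tendsto ((hform.tendsto N).comp hlim') ?_
    filter_upwards [hM] with e he using he.dotProduct_mulVec_nonneg v

lemma posSemidef_of_mul_mul {M : Matrix ι ι ℝ} (hM : M.PosSemidef) (d : ι → ℝ) :
    (of fun i j => d i * M i j * d j).PosSemidef := by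
  have hprod : (of fun i j => d i * M i j * d j) = M ⊙ vecMulVec d (star d) := by
    ext i j
    rw [of_apply, hadamard_apply, vecMulVec_apply, star_trivial]
    ring
  rw [hprod]
  exact hM.hadamard (posSemidef_vecMulVec_self_star d)

end PosSemidef

section ConditionallyPositive

variable {k : ℕ} {I : Set ℝ} {f : ℝ → ℝ}

/-- Substitute the vectors `(-∑ i, v i, v)`, whose coordinates sum to zero. -/
lemma posSemidef_of_isConditionallyPosDef {A : Matrix (Fin (k + 1)) (Fin (k + 1)) ℂ}
    (hA : IsConditionallyPosDef A) :
    (of fun i j : Fin k => A i.succ j.succ - A i.succ 0 - A 0 j.succ + A 0 0).PosSemidef := by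
  let P : Matrix (Fin (k + 1)) (Fin k) ℂ :=
    of (Fin.cons (fun _ => -1) fun i => (1 : Matrix _ _ ℂ) i)
  have hP0 : ∀ j, P 0 j = -1 := fun j => rfl
  have hPsucc : ∀ i j, P i.succ j = (1 : Matrix (Fin k) (Fin k) ℂ) i j := fun i j => rfl
  have hcomp : Pᴴ * A * P
      = of fun i j : Fin k => A i.succ j.succ - A i.succ 0 - A 0 j.succ + A 0 0 := by
    ext i j
    have hleft : (Pᴴ * A) i = fun b => A i.succ b - A 0 b := by
      ext b
      simp [Matrix.mul_apply, Fin.sum_univ_succ, hP0, hPsucc, Matrix.one_apply, sub_eq_neg_add]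
    rw [Matrix.mul_apply, Fin.sum_univ_succ, hleft]
    simp only [hP0, hPsucc, Matrix.one_apply, mul_ite, mul_one, mul_zero, Finset.sum_ite_eq',
      Finset.mem_univ, if_true, of_apply]
    ring
  have hsum : ∀ v, ∑ i, (P *ᵥ v) i = 0 := fun v => by
    simp [mulVec, dotProduct, Fin.sum_univ_succ, hP0, hPsucc, Matrix.one_apply]
  have hherm : (Pᴴ * A * P).IsHermitian := isHermitian_conjTranspose_mul_mul P hA.1
  rw [← hcomp]
  refine PosSemidef.of_dotProduct_mulVec_nonneg hherm fun v => ?_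
  rw [Complex.nonneg_iff]
  refine ⟨?_, (hherm.im_star_dotProduct_mulVec_self v).symm⟩
  simpa only [star_mulVec, dotProduct_mulVec, vecMul_vecMul] using hA.2 (P *ᵥ v) (hsum v)

lemma posSemidef_of_mem_classQ (hf : f ∈ classQ (k + 1) I) {c : Fin k → ℝ} (hc : ∀ i, c i ∈ I)
    {x : ℝ} (hx : x ∈ I) :
    (of fun i j => dividedDiff I f (c i) (c j) - dividedDiff I f (c i) x
      - dividedDiff I f x (c j) + dividedDiff I f x x).PosSemidef := by
  rw [← posSemidef_map_ofReal_iff]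
  convert posSemidef_of_isConditionallyPosDef (hf.2 (Fin.cons x c) (Fin.cases hx hc)) using 1
  ext i j
  simp [loewnerMatrix]

lemma two_mul_dividedDiff_le_of_mem_classQ [NeZero k] (hf : f ∈ classQ (k + 1) I) {s t : ℝ}
    (hs : s ∈ I) (ht : t ∈ I) :
    2 * dividedDiff I f s t ≤ derivWithin f I s + derivWithin f I t := by
  have h := (posSemidef_of_mem_classQ hf (c := fun _ : Fin k => s) (fun _ => hs) ht).diag_nonneg
    (i := 0)
  rw [of_apply, dividedDiff_comm I f t s, dividedDiff_self, dividedDiff_self] at h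
  linarith

end ConditionallyPositive

section FunctionalCalculus

variable {ι : Type*} [Fintype ι] [DecidableEq ι] {X : Matrix ι ι ℂ}

lemma continuousOn_real_spectrum (f : ℝ → ℝ) : ContinuousOn f (spectrum ℝ X) :=
  Matrix.finite_real_spectrum.continuousOn f

/-- The orthogonal projection onto the line spanned by the `l`-th vector of the eigenbasis of a
Hermitian matrix. -/
noncomputable def eigenprojection (hX : X.IsHermitian) (l : ι) : Matrix ι ι ℂ :=
  vecMulVec (hX.eigenvectorBasis l) (star ⇑(hX.eigenvectorBasis l))

lemma posSemidef_eigenprojection (hX : X.IsHermitian) (l : ι) :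
    (eigenprojection hX l).PosSemidef :=
  posSemidef_vecMulVec_self_star _

lemma cfc_eq_sum_eigenprojection (hX : X.IsHermitian) (f : ℝ → ℝ) :
    cfc f X = ∑ l, f (hX.eigenvalues l) • eigenprojection hX l := by
  rw [hX.cfc_eq, IsHermitian.cfc, Unitary.conjStarAlgAut_apply]
  ext i j
  rw [Matrix.mul_apply, Matrix.sum_apply]
  refine Finset.sum_congr rfl fun l _ => ?_
  rw [Matrix.mul_diagonal]
  simp [eigenprojection, vecMulVec_apply, Matrix.star_apply, mul_comm, mul_assoc]

lemma sum_eigenvalues_smul_eigenprojection (hX : X.IsHermitian) :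
    ∑ l, hX.eigenvalues l • eigenprojection hX l = X := by
  rw [← cfc_eq_sum_eigenprojection hX fun x => x, cfc_id' ℝ X hX.isSelfAdjoint]

lemma sum_eigenprojection (hX : X.IsHermitian) : ∑ l, eigenprojection hX l = 1 := by
  simpa only [one_smul, cfc_const_one ℝ X hX.isSelfAdjoint] using
    (cfc_eq_sum_eigenprojection hX fun _ => 1).symm

/-- By the spectral decomposition the matrix is a sum of Hadamard products of positive semidefinite
matrices, so this is the Schur product theorem. -/
lemma posSemidef_of_cfc_entries (hX : X.IsHermitian) {e : ι → ι → ℝ → ℝ}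
    (he : ∀ x ∈ spectrum ℝ X, (of fun i j => e i j x).PosSemidef) :
    (of fun i j => cfc (e i j) X i j).PosSemidef := by
  have hsum : (of fun i j => cfc (e i j) X i j) = ∑ l,
      (of fun i j => e i j (hX.eigenvalues l)).map Complex.ofReal ⊙ eigenprojection hX l := by
    ext i j
    simp [cfc_eq_sum_eigenprojection hX, Matrix.sum_apply]
  rw [hsum]
  exact posSemidef_sum _ fun l _ => (posSemidef_map_ofReal_iff.2
    (he _ (hX.eigenvalues_mem_spectrum_real l))).hadamard (posSemidef_eigenprojection hX l)

lemma re_star_dotProduct_mulVec_mem_of_convex {I : Set ℝ} (hI : Convex ℝ I) (hX : X.IsHermitian)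
    (hs : spectrum ℝ X ⊆ I) {v : ι → ℂ} (hv : star v ⬝ᵥ v = 1) :
    (star v ⬝ᵥ X *ᵥ v).re ∈ I := by
  let w : ι → ℝ := fun l => (star v ⬝ᵥ eigenprojection hX l *ᵥ v).re
  have hw : ∑ l, w l = 1 := by
    rw [← Complex.re_sum, ← dotProduct_sum, ← Matrix.sum_mulVec, sum_eigenprojection, one_mulVec,
      hv, Complex.one_re]
  have hXv : (star v ⬝ᵥ X *ᵥ v).re = ∑ l, w l • hX.eigenvalues l := by
    conv_lhs => rw [← sum_eigenvalues_smul_eigenprojection hX]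
    rw [Matrix.sum_mulVec, dotProduct_sum, Complex.re_sum]
    simp only [smul_mulVec, dotProduct_smul, Complex.smul_re, smul_eq_mul, w, mul_comm]
  rw [hXv]
  exact hI.sum_mem (fun l _ => (posSemidef_eigenprojection hX l).re_dotProduct_nonneg v) hw
    fun l _ => hs (hX.eigenvalues_mem_spectrum_real l)

lemma spectrum_convexCombination_subset {I : Set ℝ} (hI : Convex ℝ I) {A B : Matrix ι ι ℂ}
    (hA : A.IsHermitian) (hB : B.IsHermitian) (hsA : spectrum ℝ A ⊆ I) (hsB : spectrum ℝ B ⊆ I)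
    {a b : ℝ} (ha : 0 ≤ a) (hb : 0 ≤ b) (hab : a + b = 1) :
    spectrum ℝ (a • A + b • B) ⊆ I := by
  have hC : (a • A + b • B).IsHermitian :=
    (hA.smul (IsSelfAdjoint.all a)).add (hB.smul (IsSelfAdjoint.all b))
  rw [hC.spectrum_real_eq_range_eigenvalues]
  rintro _ ⟨l, rfl⟩
  have hv : star ⇑(hC.eigenvectorBasis l) ⬝ᵥ ⇑(hC.eigenvectorBasis l) = 1 := by
    rw [dotProduct_comm, ← EuclideanSpace.inner_eq_star_dotProduct, inner_self_eq_norm_sq_to_K,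
      hC.eigenvectorBasis.orthonormal.1 l, RCLike.ofReal_one, one_pow]
  rw [hC.eigenvalues_eq, RCLike.re_eq_complex_re, add_mulVec, dotProduct_add, smul_mulVec,
    smul_mulVec, dotProduct_smul, dotProduct_smul, Complex.add_re, Complex.smul_re, Complex.smul_re]
  exact hI (re_star_dotProduct_mulVec_mem_of_convex hI hA hsA hv)
    (re_star_dotProduct_mulVec_mem_of_convex hI hB hsB hv) ha hb hab

omit [Fintype ι] in
lemma isHermitian_diagonal_ofReal (c : ι → ℝ) : (diagonal fun i => (c i : ℂ)).IsHermitian :=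
  isHermitian_diagonal_of_self_adjoint _ (by ext i; simp)

lemma spectrum_real_diagonal_ofReal (c : ι → ℝ) :
    spectrum ℝ (diagonal fun i => (c i : ℂ)) = range c := by
  ext x
  rw [← spectrum.algebraMap_mem_iff ℂ, spectrum_diagonal]
  simp

lemma cfc_sub_algebraMap_eq_mul (hX : X.IsHermitian) (g : ℝ → ℝ) (a : ℝ) :
    cfc g X - algebraMap ℝ _ (g a) = (X - algebraMap ℝ _ a) * cfc (dslope g a) X := by
  have hcont := continuousOn_real_spectrum (X := X)
  have hX' : IsSelfAdjoint X := hX.isSelfAdjoint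
  calc cfc g X - algebraMap ℝ _ (g a) = cfc (fun x => g x - g a) X := by
        rw [cfc_sub _ _ X (hcont _) (hcont _), cfc_const _ X]
    _ = cfc (fun x => (x - a) * dslope g a x) X := by
        simp only [← smul_eq_mul, sub_smul_dslope]
    _ = (X - algebraMap ℝ _ a) * cfc (dslope g a) X := by
        rw [cfc_mul _ _ X (hcont _) (hcont _), cfc_sub _ _ X (hcont _) (hcont _), cfc_const _ X,
          cfc_id' ℝ X]

end FunctionalCalculus

section LoewnerMatrix

variable {ι : Type*} [Fintype ι] [DecidableEq ι]

lemma cfc_sub_diagonal_apply {X : Matrix ι ι ℂ} (hX : X.IsHermitian) (g : ℝ → ℝ) (c : ι → ℝ)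
    (i j : ι) : (cfc g X - diagonal fun i => (g (c i) : ℂ)) i j =
      ((X - diagonal fun i => (c i : ℂ)) * cfc (dslope g (c i)) X) i j := by
  have hrow (d : ι → ℝ) (m : ι) :
      algebraMap ℝ (Matrix ι ι ℂ) (d i) i m = diagonal (fun i => (d i : ℂ)) i m := by
    simp [Matrix.algebraMap_matrix_apply, diagonal_apply]
  have h := congrFun₂ (cfc_sub_algebraMap_eq_mul hX g (c i)) i j
  simp only [Matrix.sub_apply, Matrix.mul_apply, hrow c, hrow fun i => g (c i)] at h ⊢
  exact h

lemma cfc_diagonal_ofReal (g : ℝ → ℝ) (c : ι → ℝ) :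
    cfc g (diagonal fun i => (c i : ℂ)) = diagonal fun i => (g (c i) : ℂ) := by
  refine sub_eq_zero.1 (Matrix.ext fun i j => ?_)
  rw [cfc_sub_diagonal_apply (isHermitian_diagonal_ofReal c), sub_self, zero_mul]

open scoped Matrix.Norms.L2Operator in
lemma eventually_spectrum_real_subset {β : Type*} {l : Filter β} {U : Set ℝ} (hU : IsOpen U)
    {B : β → Matrix ι ι ℂ} {A : Matrix ι ι ℂ} (hlim : Tendsto B l (𝓝 A))
    (hA : spectrum ℝ A ⊆ U) : ∀ᶠ t in l, spectrum ℝ (B t) ⊆ U := by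
  filter_upwards [hlim.eventually
    (upperHemicontinuous_spectrum ℝ (Matrix ι ι ℂ) A U (hU.mem_nhdsSet.2 hA))] with t ht
    using subset_of_mem_nhdsSet ht

open scoped Matrix.Norms.L2Operator in
lemma tendsto_cfc_of_spectrum_subset {β : Type*} {l : Filter β} {U : Set ℝ} (hU : IsOpen U)
    {g : ℝ → ℝ} (hg : ContinuousOn g U) {B : β → Matrix ι ι ℂ} {A : Matrix ι ι ℂ}
    (hlim : Tendsto B l (𝓝 A)) (hB : ∀ t, (B t).IsHermitian) (hA : A.IsHermitian)
    (hAU : spectrum ℝ A ⊆ U) : Tendsto (fun t => cfc g (B t)) l (𝓝 (cfc g A)) := by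
  obtain ⟨K, hK, hAK, hKU⟩ := exists_compact_between
    (Matrix.finite_real_spectrum (A := A)).isCompact hU hAU
  exact hlim.cfc hK g
    ((eventually_spectrum_real_subset isOpen_interior hlim hAK).mono
      fun t ht => ht.trans interior_subset)
    (Eventually.of_forall fun t => (hB t).isSelfAdjoint) (hAK.trans interior_subset)
    hA.isSelfAdjoint (hg.mono hKU)

omit [Fintype ι] [DecidableEq ι] in
lemma tendsto_add_smul_nhdsGT_zero (A H : Matrix ι ι ℂ) :
    Tendsto (fun t : ℝ => A + t • H) (𝓝[>] 0) (𝓝 A) := by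
  have h : Continuous fun t : ℝ => A + t • H := by fun_prop
  simpa only [zero_smul, add_zero] using (h.tendsto 0).mono_left nhdsWithin_le_nhds

/-- This is the Daleckii–Krein formula at a diagonal matrix. -/
lemma tendsto_slope_cfc_diagonal {U : Set ℝ} (hU : IsOpen U) {g : ℝ → ℝ}
    (hg : DifferentiableOn ℝ g U) {c : ι → ℝ} (hc : ∀ i, c i ∈ U) {H : Matrix ι ι ℂ}
    (hH : H.IsHermitian) (i j : ι) :
    Tendsto (fun t : ℝ => (t⁻¹ • (cfc g ((diagonal fun i => (c i : ℂ)) + t • H) -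
      cfc g (diagonal fun i => (c i : ℂ)))) i j) (𝓝[>] 0) (𝓝 (H i j * dslope g (c i) (c j))) := by
  set D : Matrix ι ι ℂ := diagonal fun i => (c i : ℂ) with hD
  have hDh : D.IsHermitian := isHermitian_diagonal_ofReal c
  have hBh (t : ℝ) : (D + t • H).IsHermitian := hDh.add (hH.smul (IsSelfAdjoint.all t))
  have hDU : spectrum ℝ D ⊆ U :=
    (spectrum_real_diagonal_ofReal c).trans_subset (range_subset_iff.2 hc)
  have hdslope : ContinuousOn (dslope g (c i)) U :=
    (continuousOn_dslope (hU.mem_nhds (hc i))).2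
      ⟨hg.continuousOn, hg.differentiableAt (hU.mem_nhds (hc i))⟩
  have hlim : Tendsto (fun t : ℝ => (H * cfc (dslope g (c i)) (D + t • H)) i j) (𝓝[>] 0)
      (𝓝 (H i j * dslope g (c i) (c j))) := by
    have h := (tendsto_cfc_of_spectrum_subset hU hdslope (tendsto_add_smul_nhdsGT_zero D H)
      hBh hDh hDU).const_mul H
    have hij := ((continuous_apply_apply i j).tendsto _).comp h
    rwa [cfc_diagonal_ofReal, Matrix.mul_diagonal] at hij
  refine hlim.congr' ?_
  filter_upwards [self_mem_nhdsWithin] with t ht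
  rw [cfc_diagonal_ofReal, Matrix.smul_apply, cfc_sub_diagonal_apply (hBh t), ← hD,
    add_sub_cancel_left, smul_mul, Matrix.smul_apply, inv_smul_smul₀ (ne_of_gt ht)]

end LoewnerMatrix

lemma IsMatrixMonotoneOn.posSemidef_dslope {k : ℕ} {U : Set ℝ} {g : ℝ → ℝ}
    (hmono : IsMatrixMonotoneOn k U g) (hU : IsOpen U) (hg : DifferentiableOn ℝ g U)
    {c : Fin k → ℝ} (hc : ∀ i, c i ∈ U) :
    (of fun i j => dslope g (c i) (c j)).PosSemidef := by
  set D : Matrix (Fin k) (Fin k) ℂ := diagonal fun i => (c i : ℂ)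
  have hDh : D.IsHermitian := isHermitian_diagonal_ofReal c
  have hDU : spectrum ℝ D ⊆ U :=
    (spectrum_real_diagonal_ofReal c).trans_subset (range_subset_iff.2 hc)
  let J : Matrix (Fin k) (Fin k) ℂ := vecMulVec 1 (star 1)
  have hJ : J.PosSemidef := posSemidef_vecMulVec_self_star 1
  refine posSemidef_map_ofReal_iff.1 (posSemidef_of_tendsto (l := 𝓝[>] (0 : ℝ))
    (M := fun t => t⁻¹ • (cfc g (D + t • J) - cfc g D)) ?_ fun i j => ?_)
  · filter_upwards [self_mem_nhdsWithin,
      eventually_spectrum_real_subset hU (tendsto_add_smul_nhdsGT_zero D J) hDU] with t ht hBU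
    have ht : 0 ≤ t := le_of_lt ht
    refine (hmono D _ hDh (hDh.add (hJ.isHermitian.smul (IsSelfAdjoint.all t))) hDU hBU ?_).smul
      (inv_nonneg.2 ht)
    simpa only [add_sub_cancel_left] using hJ.smul ht
  · have h := tendsto_slope_cfc_diagonal hU hg hc hJ.isHermitian i j
    rw [show J i j = 1 by simp [J], one_mul] at h
    exact h

section KrausCriterion

variable {k : ℕ} {I : Set ℝ} {f : ℝ → ℝ}

/-- The matrix `(f x - f (c i) - [c i, c j]_f (x - c i))`: up to the congruence by
`diagonal (x - c i)`, it is the matrix of second divided differences `[c i, c j, x]_f` by which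
Kraus characterized matrix convexity. -/
noncomputable def krausMatrix {ι : Type*} (I : Set ℝ) (f : ℝ → ℝ) (c : ι → ℝ) (x : ℝ) :
    Matrix ι ι ℝ :=
  of fun i j => interpolationError I f (c i) (c j) x

lemma cfc_interpolationError {ι : Type*} [Fintype ι] [DecidableEq ι] {X : Matrix ι ι ℂ}
    (hX : X.IsHermitian) (I : Set ℝ) (f : ℝ → ℝ) (s t : ℝ) :
    cfc (interpolationError I f s t) X =
      cfc f X - algebraMap ℝ _ (f s) - dividedDiff I f s t • (X - algebraMap ℝ _ s) := by
  have hcont := continuousOn_real_spectrum (X := X)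
  have hX' : IsSelfAdjoint X := hX.isSelfAdjoint
  unfold interpolationError
  rw [cfc_sub _ _ X (hcont _) (hcont _), cfc_sub _ _ X (hcont _) (hcont _), cfc_const _ X,
    cfc_const_mul _ _ X (hcont _), cfc_sub _ _ X (hcont _) (hcont _), cfc_const _ X, cfc_id' ℝ X]

/-- The Hadamard product with the Loewner matrix is the derivative of `cfc f` at `diagonal c`, so
this says that `f` lies above its tangent there. -/
lemma posSemidef_cfc_sub_loewnerMatrix_hadamard {X : Matrix (Fin k) (Fin k) ℂ}
    (hX : X.IsHermitian) {c : Fin k → ℝ}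
    (hc : ∀ x ∈ spectrum ℝ X, (krausMatrix I f c x).PosSemidef) :
    (cfc f X - (diagonal fun i => (f (c i) : ℂ)) -
      loewnerMatrix I f c ⊙ (X - diagonal fun i => (c i : ℂ))).PosSemidef := by
  have h := posSemidef_of_cfc_entries hX (e := fun i j => interpolationError I f (c i) (c j)) hc
  convert h using 1
  ext i j
  rw [of_apply, cfc_interpolationError hX]
  simp [loewnerMatrix, Matrix.algebraMap_matrix_apply, diagonal_apply]

lemma posSemidef_convexCombination_sub_diagonal {A B : Matrix (Fin k) (Fin k) ℂ}
    (hA : A.IsHermitian) (hB : B.IsHermitian) {a b : ℝ} (ha : 0 ≤ a) (hb : 0 ≤ b)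
    (hab : a + b = 1) {c : Fin k → ℝ} (hABc : a • A + b • B = diagonal fun i => (c i : ℂ))
    (hcA : ∀ x ∈ spectrum ℝ A, (krausMatrix I f c x).PosSemidef)
    (hcB : ∀ x ∈ spectrum ℝ B, (krausMatrix I f c x).PosSemidef) :
    (a • cfc f A + b • cfc f B - diagonal fun i => (f (c i) : ℂ)).PosSemidef := by
  have h := ((posSemidef_cfc_sub_loewnerMatrix_hadamard hA hcA).smul ha).add
    ((posSemidef_cfc_sub_loewnerMatrix_hadamard hB hcB).smul hb)
  convert h using 1
  have hlinear : a • loewnerMatrix I f c ⊙ (A - diagonal fun i => (c i : ℂ)) +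
      b • loewnerMatrix I f c ⊙ (B - diagonal fun i => (c i : ℂ)) = 0 := by
    rw [← hadamard_smul, ← hadamard_smul, ← hadamard_add, smul_sub, smul_sub, sub_add_sub_comm,
      hABc, ← add_smul, hab, one_smul, sub_self, hadamard_zero]
  linear_combination (norm := module) hlinear + hab • diagonal fun i => (f (c i) : ℂ)

lemma posSemidef_conjStarAlgAut_iff {ι : Type*} [Fintype ι] [DecidableEq ι]
    (U : unitary (Matrix ι ι ℂ)) {M : Matrix ι ι ℂ} :
    (Unitary.conjStarAlgAut ℝ _ U M).PosSemidef ↔ M.PosSemidef := by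
  rw [Unitary.conjStarAlgAut_apply]
  exact (Unitary.isUnit_coe).posSemidef_star_right_conjugate_iff

lemma conjStarAlgAut_cfc {ι : Type*} [Fintype ι] [DecidableEq ι] (U : unitary (Matrix ι ι ℂ))
    {X : Matrix ι ι ℂ} (hX : X.IsHermitian) (g : ℝ → ℝ) :
    Unitary.conjStarAlgAut ℝ _ U (cfc g X) = cfc g (Unitary.conjStarAlgAut ℝ _ U X) :=
  StarAlgHomClass.map_cfc _ g X (continuousOn_real_spectrum g) (by
    change Continuous fun Y : Matrix ι ι ℂ => (U : Matrix ι ι ℂ) * Y * star (U : Matrix ι ι ℂ)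
    fun_prop) hX.isSelfAdjoint
    (hX.isSelfAdjoint.map _)

lemma isMatrixConvexOn_of_posSemidef_krausMatrix (hI : Convex ℝ I)
    (h : ∀ c : Fin k → ℝ, (∀ i, c i ∈ I) → ∀ x ∈ I, (krausMatrix I f c x).PosSemidef) :
    IsMatrixConvexOn k I f := by
  intro A B hA hB hsA hsB a ha
  set C := a • A + (1 - a) • B with hCdef
  have hC : C.IsHermitian :=
    (hA.smul (IsSelfAdjoint.all a)).add (hB.smul (IsSelfAdjoint.all (1 - a)))
  have hsC : spectrum ℝ C ⊆ I := spectrum_convexCombination_subset hI hA hB hsA hsB ha.1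
    (sub_nonneg.2 ha.2) (add_sub_cancel _ _)
  let φ := Unitary.conjStarAlgAut ℝ (Matrix (Fin k) (Fin k) ℂ) (star hC.eigenvectorUnitary)
  have hφC : φ C = diagonal fun i => (hC.eigenvalues i : ℂ) :=
    hC.conjStarAlgAut_star_eigenvectorUnitary
  have hkraus {X : Matrix (Fin k) (Fin k) ℂ} (hs : spectrum ℝ X ⊆ I) :
      ∀ x ∈ spectrum ℝ (φ X), (krausMatrix I f hC.eigenvalues x).PosSemidef := by
    rw [AlgEquiv.spectrum_eq φ]
    exact fun x hx => h _ (fun i => hsC (hC.eigenvalues_mem_spectrum_real i)) x (hs hx)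
  rw [← posSemidef_conjStarAlgAut_iff (star hC.eigenvectorUnitary)]
  have hdiag := posSemidef_convexCombination_sub_diagonal (hA.isSelfAdjoint.map φ)
    (hB.isSelfAdjoint.map φ) ha.1 (sub_nonneg.2 ha.2) (add_sub_cancel _ _)
    (by rw [← hφC, hCdef, map_add, map_smul, map_smul]) (hkraus hsA) (hkraus hsB)
  rwa [← cfc_diagonal_ofReal, ← hφC, ← conjStarAlgAut_cfc _ hA, ← conjStarAlgAut_cfc _ hB,
    ← conjStarAlgAut_cfc _ hC, ← map_smul, ← map_smul, ← map_add, ← map_sub] at hdiag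

end KrausCriterion

section MatrixMonotone

variable {k : ℕ} {I : Set ℝ} {f : ℝ → ℝ}

lemma IsMatrixMonotoneOn.congr {g : ℝ → ℝ} (hf : IsMatrixMonotoneOn k I f) (hfg : EqOn f g I) :
    IsMatrixMonotoneOn k I g := by
  intro A B hA hB hsA hsB hAB
  rw [← cfc_congr (hfg.mono hsA), ← cfc_congr (hfg.mono hsB)]
  exact hf A B hA hB hsA hsB hAB

lemma IsMatrixMonotoneOn.comp_mul_left (hf : IsMatrixMonotoneOn k I f) {J : Set ℝ} {s : ℝ}
    (hs : 0 ≤ s) (hJ : MapsTo (s * ·) J I) : IsMatrixMonotoneOn k J fun x => f (s * x) := by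
  intro A B hA hB hsA hsB hAB
  have hcomp {X : Matrix (Fin k) (Fin k) ℂ} (hX : X.IsHermitian) :
      cfc (fun x => f (s * x)) X = cfc f (s • X) :=
    cfc_comp_smul s f X ((Matrix.finite_real_spectrum.image _).continuousOn f) hX.isSelfAdjoint
  have hspec {X : Matrix (Fin k) (Fin k) ℂ} (hX : X.IsHermitian) (hsX : spectrum ℝ X ⊆ J) :
      spectrum ℝ (s • X) ⊆ I := by
    rw [← cfc_const_mul_id s X hX.isSelfAdjoint, cfc_map_spectrum _ X hX.isSelfAdjoint
      (continuousOn_real_spectrum _)]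
    exact (hJ.mono_left hsX).image_subset
  rw [hcomp hA, hcomp hB]
  refine hf _ _ (hA.smul (IsSelfAdjoint.all s)) (hB.smul (IsSelfAdjoint.all s)) (hspec hA hsA)
    (hspec hB hsB) ?_
  simpa only [smul_sub] using hAB.smul hs

open MeasureTheory
open scoped MatrixOrder Matrix.Norms.L2Operator

lemma integrable_cfc_of_forall_spectrum {ι Ω : Type*} [Fintype ι] [DecidableEq ι]
    [MeasurableSpace Ω] {μ : Measure Ω} {F : Ω → ℝ → ℝ} {X : Matrix ι ι ℂ} (hX : X.IsHermitian)
    (hF : ∀ x ∈ spectrum ℝ X, Integrable (F · x) μ) : Integrable (fun ω => cfc (F ω) X) μ := by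
  simp only [cfc_eq_sum_eigenprojection hX]
  exact integrable_finsetSum _ fun l _ =>
    (hF _ (hX.eigenvalues_mem_spectrum_real l)).smul_const _

lemma cfc_integral_of_forall_spectrum {ι Ω : Type*} [Fintype ι] [DecidableEq ι]
    [MeasurableSpace Ω] {μ : Measure Ω} {F : Ω → ℝ → ℝ} {X : Matrix ι ι ℂ} (hX : X.IsHermitian)
    (hF : ∀ x ∈ spectrum ℝ X, Integrable (F · x) μ) :
    cfc (fun x => ∫ ω, F ω x ∂μ) X = ∫ ω, cfc (F ω) X ∂μ := by
  simp only [cfc_eq_sum_eigenprojection hX]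
  rw [integral_finsetSum _ fun l _ => (hF _ (hX.eigenvalues_mem_spectrum_real l)).smul_const _]
  simp only [integral_smul_const]

lemma IsMatrixMonotoneOn.integral {Ω : Type*} [MeasurableSpace Ω] {μ : Measure Ω}
    {F : Ω → ℝ → ℝ} (hmono : ∀ᵐ ω ∂μ, IsMatrixMonotoneOn k I (F ω))
    (hint : ∀ x ∈ I, Integrable (F · x) μ) : IsMatrixMonotoneOn k I fun x => ∫ ω, F ω x ∂μ := by
  intro A B hA hB hsA hsB hAB
  rw [cfc_integral_of_forall_spectrum hA fun x hx => hint x (hsA hx),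
    cfc_integral_of_forall_spectrum hB fun x hx => hint x (hsB hx), ← Matrix.le_iff]
  refine integral_mono_ae (integrable_cfc_of_forall_spectrum hA fun x hx => hint x (hsA hx))
    (integrable_cfc_of_forall_spectrum hB fun x hx => hint x (hsB hx)) ?_
  filter_upwards [hmono] with ω hω
  exact Matrix.le_iff.2 (hω A B hA hB hsA hsB hAB)

end MatrixMonotone

section Slope

variable {k : ℕ} {α : EReal} {f : ℝ → ℝ}

lemma hasDerivAt_derivWithin {I : Set ℝ} {x : ℝ} (hf : DifferentiableOn ℝ f I) (hx : I ∈ 𝓝 x) :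
    HasDerivAt f (derivWithin f I x) x :=
  (hf x (mem_of_mem_nhds hx)).hasDerivWithinAt.hasDerivAt hx

lemma mul_mem_halfOpenInterval {s x : ℝ} (hs : s ∈ Icc (0 : ℝ) 1) (hx : x ∈ halfOpenInterval α) :
    s * x ∈ halfOpenInterval α :=
  mem_halfOpenInterval_of_le hx (mul_nonneg hs.1 hx.1) (mul_le_of_le_one_left hx.1 hs.2)

lemma continuousOn_comp_mul_right {g : ℝ → ℝ} (hg : ContinuousOn g (halfOpenInterval α)) {x : ℝ}
    (hx : x ∈ halfOpenInterval α) : ContinuousOn (fun s => g (s * x)) (Icc 0 1) :=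
  hg.comp (by fun_prop) fun _ hs => mul_mem_halfOpenInterval hs hx

lemma integral_derivWithin_mul_eq_slope (hf : ContDiffOn ℝ 1 f (halfOpenInterval α)) {x : ℝ}
    (hx : x ∈ halfOpenInterval α) (h0 : 0 < x) :
    ∫ s in Ioc (0 : ℝ) 1, derivWithin f (halfOpenInterval α) (s * x) = slope f 0 x := by
  set I := halfOpenInterval α
  have hα : 0 < α := (EReal.coe_pos.2 h0).trans hx.2
  have hderiv (s : ℝ) (hs : s ∈ Ioo (0 : ℝ) 1) :
      HasDerivAt (fun s => f (s * x) / x) (derivWithin f I (s * x)) s := by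
    have hsx : I ∈ 𝓝 (s * x) := halfOpenInterval_mem_nhds
      (mul_mem_halfOpenInterval (Ioo_subset_Icc_self hs) hx) (mul_pos hs.1 h0)
    simpa [mul_div_cancel_right₀ _ h0.ne'] using!
      ((hasDerivAt_derivWithin (hf.differentiableOn one_ne_zero) hsx).comp s
        ((hasDerivAt_id s).mul_const x)).div_const x
  have hcont : ContinuousOn (fun s => derivWithin f I (s * x)) (Icc 0 1) :=
    continuousOn_comp_mul_right
      (hf.continuousOn_derivWithin (uniqueDiffOn_halfOpenInterval hα) le_rfl) hx
  rw [← intervalIntegral.integral_of_le zero_le_one,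
    intervalIntegral.integral_eq_sub_of_hasDerivAt_of_le zero_le_one
      ((continuousOn_comp_mul_right hf.continuousOn hx).div_const x) hderiv
      (hcont.intervalIntegrable_of_Icc zero_le_one),
    slope_def_field, one_mul, zero_mul, sub_zero, sub_div]

open MeasureTheory in
lemma isMatrixMonotoneOn_slope_zero (hf : ContDiffOn ℝ 1 f (halfOpenInterval α))
    (hmono : IsMatrixMonotoneOn k (halfOpenInterval α) (derivWithin f (halfOpenInterval α))) :
    IsMatrixMonotoneOn k (halfOpenInterval α ∩ Ioi 0) (slope f 0) := by
  have h : IsMatrixMonotoneOn k (halfOpenInterval α ∩ Ioi 0) fun x =>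
      ∫ s in Ioc (0 : ℝ) 1, derivWithin f (halfOpenInterval α) (s * x) := by
    refine IsMatrixMonotoneOn.integral ?_ fun x hx => ?_
    · filter_upwards [ae_restrict_mem measurableSet_Ioc] with s hs
      exact hmono.comp_mul_left hs.1.le
        fun x hx => mul_mem_halfOpenInterval (Ioc_subset_Icc_self hs) hx.1
    · have hα : 0 < α := (EReal.coe_pos.2 hx.2).trans hx.1.2
      exact (continuousOn_comp_mul_right (hf.continuousOn_derivWithin
        (uniqueDiffOn_halfOpenInterval hα) le_rfl) hx.1).integrableOn_Icc.mono_set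
        Ioc_subset_Icc_self
  exact h.congr fun x hx => integral_derivWithin_mul_eq_slope hf hx.1 hx.2

lemma secondDividedDiff_eq_dslope_slope {I : Set ℝ} {a s t : ℝ}
    (hf : HasDerivAt f (derivWithin f I s) s) (hs : s ≠ a) (ht : t ≠ a) :
    secondDividedDiff I f s t a = dslope (slope f a) s t := by
  have hsa := sub_ne_zero.2 hs
  have hta := sub_ne_zero.2 ht
  unfold secondDividedDiff interpolationError
  rw [← neg_sub s a, ← neg_sub t a]
  rcases eq_or_ne t s with rfl | hst
  · have hslope : HasDerivAt (slope f a)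
        ((derivWithin f I t * (t - a) - (f t - f a) * 1) / (t - a) ^ 2) t := by
      rw [slope_fun_def_field]
      exact (hf.sub_const _).div ((hasDerivAt_id t).sub_const a) hta
    rw [dslope_same, hslope.deriv, dividedDiff_self]
    field_simp
    ring
  · have hts := sub_ne_zero.2 hst
    rw [dslope_of_ne _ hst, dividedDiff_of_ne I f hst.symm, dslope_of_ne _ hst]
    simp only [slope_def_field]
    field_simp
    ring

lemma posSemidef_secondDividedDiffMatrix_zero (hf : ContDiffOn ℝ 1 f (halfOpenInterval α))
    (hmono : IsMatrixMonotoneOn k (halfOpenInterval α) (derivWithin f (halfOpenInterval α)))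
    {c : Fin k → ℝ} (hc : ∀ i, c i ∈ halfOpenInterval α) (hc0 : ∀ i, 0 < c i) :
    (secondDividedDiffMatrix (halfOpenInterval α) f c 0).PosSemidef := by
  set I := halfOpenInterval α
  have hfd : DifferentiableOn ℝ f I := hf.differentiableOn one_ne_zero
  have hnhds (x : ℝ) (hx : x ∈ I ∩ Ioi 0) : I ∈ 𝓝 x := halfOpenInterval_mem_nhds hx.1 hx.2
  have hopen : IsOpen (I ∩ Ioi 0) :=
    isOpen_iff_mem_nhds.2 fun x hx => inter_mem (hnhds x hx) (Ioi_mem_nhds hx.2)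
  have hslope : DifferentiableOn ℝ (slope f 0) (I ∩ Ioi 0) := by
    rw [slope_fun_def_field]
    exact ((hfd.mono inter_subset_left).sub_const _).div (by fun_prop)
      fun x hx => sub_ne_zero.2 (ne_of_gt hx.2)
  convert (isMatrixMonotoneOn_slope_zero hf hmono).posSemidef_dslope hopen hslope
    fun i => ⟨hc i, hc0 i⟩ using 1
  ext i j
  exact secondDividedDiff_eq_dslope_slope
    (hasDerivAt_derivWithin hfd (hnhds _ ⟨hc i, hc0 i⟩)) (hc0 i).ne' (hc0 j).ne'

end Slope

section Monotonicity

variable {ι : Type*} [Fintype ι]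

lemma hasDerivAt_dotProduct_mulVec {M : ℝ → Matrix ι ι ℝ} {M' : Matrix ι ι ℝ} {x : ℝ}
    (hM : ∀ i j, HasDerivAt (fun x => M x i j) (M' i j) x) (v w : ι → ℝ) :
    HasDerivAt (fun x => v ⬝ᵥ M x *ᵥ w) (v ⬝ᵥ M' *ᵥ w) x :=
  HasDerivAt.fun_sum fun i _ => (HasDerivAt.fun_sum fun j _ => (hM i j).mul_const (w j)).const_mul _

lemma tendsto_dotProduct_mulVec {β : Type*} {l : Filter β} {M : β → Matrix ι ι ℝ}
    {N : Matrix ι ι ℝ} (hM : ∀ i j, Tendsto (fun e => M e i j) l (𝓝 (N i j))) (v w : ι → ℝ) :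
    Tendsto (fun e => v ⬝ᵥ M e *ᵥ w) l (𝓝 (v ⬝ᵥ N *ᵥ w)) :=
  tendsto_finsetSum _ fun i _ =>
    (tendsto_finsetSum _ fun j _ => (hM i j).mul_const (w j)).const_mul _

lemma continuousOn_dotProduct_mulVec {M : ℝ → Matrix ι ι ℝ} {s : Set ℝ}
    (hM : ∀ i j, ContinuousOn (fun x => M x i j) s) (v w : ι → ℝ) :
    ContinuousOn (fun x => v ⬝ᵥ M x *ᵥ w) s :=
  fun x hx => tendsto_dotProduct_mulVec (fun i j => hM i j x hx) v w

variable {k : ℕ} {I : Set ℝ} {f : ℝ → ℝ}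

lemma continuousOn_secondDividedDiff (hf : ContinuousOn f I) (s t : ℝ) :
    ContinuousOn (secondDividedDiff I f s t) (I \ {s, t}) := by
  refine ContinuousOn.div ?_ (by fun_prop) fun x hx => ?_
  · exact ((hf.mono sdiff_subset).sub continuousOn_const).sub (by fun_prop)
  · have hx := hx.2
    rw [mem_insert_iff, mem_singleton_iff, not_or] at hx
    exact mul_ne_zero (sub_ne_zero.2 hx.1) (sub_ne_zero.2 hx.2)

lemma two_mul_derivWithin_le_of_mem_classQ [NeZero k] (hf : f ∈ classQ (k + 1) I) {p h : ℝ}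
    (hh : 0 < h) (hI : Icc (p - h) (p + h) ⊆ interior I) :
    2 * h * derivWithin f I p ≤ f (p + h) - f (p - h) := by
  have hright {s : ℝ} (hs : s ∈ Icc 0 h) : p + s ∈ interior I :=
    hI ⟨by linarith [hs.1], by linarith [hs.2]⟩
  have hleft {s : ℝ} (hs : s ∈ Icc 0 h) : p - s ∈ interior I :=
    hI ⟨by linarith [hs.2], by linarith [hs.1]⟩
  have hf' {x : ℝ} (hx : x ∈ interior I) : HasDerivAt f (derivWithin f I x) x :=
    hasDerivAt_derivWithin (hf.1.differentiableOn one_ne_zero) (mem_interior_iff_mem_nhds.1 hx)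
  have hderiv (s : ℝ) (hs : s ∈ Icc 0 h) : HasDerivAt (fun s => f (p + s) - f (p - s))
      (derivWithin f I (p + s) + derivWithin f I (p - s)) s := by
    simpa only [sub_neg_eq_add] using!
      ((hf' (hright hs)).comp_const_add p s).sub ((hf' (hleft hs)).comp_const_sub p s)
  have hle (s : ℝ) (hs : s ∈ Ioo 0 h) :
      f (p + s) - f (p - s) ≤ s * (derivWithin f I (p + s) + derivWithin f I (p - s)) := by
    have hs' := Ioo_subset_Icc_self hs
    calc f (p + s) - f (p - s)
        = s * (2 * dividedDiff I f (p - s) (p + s)) := by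
          rw [← dividedDiff_mul_sub I f (p - s) (p + s)]; ring
      _ ≤ s * (derivWithin f I (p - s) + derivWithin f I (p + s)) :=
          mul_le_mul_of_nonneg_left (two_mul_dividedDiff_le_of_mem_classQ hf
            (interior_subset (hleft hs')) (interior_subset (hright hs'))) hs.1.le
      _ = s * (derivWithin f I (p + s) + derivWithin f I (p - s)) := by rw [add_comm]
  have h0 : f (p + 0) - f (p - 0) = 0 := by rw [add_zero, sub_zero, sub_self]
  have := mul_deriv_zero_le_of_le_mul_deriv hh h0 hderiv hle
  rw [add_zero, sub_zero] at this
  linarith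

lemma eventually_Icc_sub_add_subset {U : Set ℝ} {p : ℝ} (hU : U ∈ 𝓝 p) :
    ∀ᶠ h in 𝓝 (0 : ℝ), Icc (p - h) (p + h) ⊆ U := by
  obtain ⟨ε, hε, hεU⟩ := Metric.nhds_basis_closedBall.mem_iff.1 hU
  filter_upwards [Iic_mem_nhds hε] with h hh
  rw [← Real.closedBall_eq_Icc]
  exact (Metric.closedBall_subset_closedBall hh).trans hεU

/-- Only the entries with `c i = c j = p` jump at `p`, and they do so by a common amount. -/
lemma tendsto_secondDividedDiffMatrix_add_sub {ι : Type*} (c : ι → ℝ) {p : ℝ}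
    (hf : DifferentiableAt ℝ f p) (i j : ι) :
    Tendsto (fun h : ℝ => (secondDividedDiffMatrix I f c (p + h) -
      secondDividedDiffMatrix I f c (p - h) -
      (secondDividedDiff I f p p (p + h) - secondDividedDiff I f p p (p - h)) •
        vecMulVec ((c ⁻¹' {p}).indicator (1 : ι → ℝ)) ((c ⁻¹' {p}).indicator 1)) i j)
      (𝓝[>] 0) (𝓝 0) := by
  simp only [Matrix.sub_apply, Matrix.smul_apply, vecMulVec_apply, secondDividedDiffMatrix,
    of_apply, smul_eq_mul]
  by_cases hij : c i = p ∧ c j = p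
  · rw [indicator_of_mem (show i ∈ c ⁻¹' {p} from hij.1),
      indicator_of_mem (show j ∈ c ⁻¹' {p} from hij.2)]
    simp only [hij.1, hij.2, Pi.one_apply, mul_one, sub_self, tendsto_const_nhds]
  · have hzero : (c ⁻¹' {p}).indicator (1 : ι → ℝ) i * (c ⁻¹' {p}).indicator 1 j = 0 := by
      rcases not_and_or.1 hij with hi | hj
      · rw [indicator_of_notMem (show i ∉ c ⁻¹' {p} from hi), zero_mul]
      · rw [indicator_of_notMem (show j ∉ c ⁻¹' {p} from hj), mul_zero]
    simp only [hzero, mul_zero, sub_zero]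
    exact tendsto_secondDividedDiff_add_sub hf ((not_and_or.1 hij).imp Ne.symm Ne.symm)

lemma eventually_dotProduct_secondDividedDiffMatrix_le_add [NeZero k] (hf : f ∈ classQ (k + 1) I)
    (c v : Fin k → ℝ) {p : ℝ} (hp : p ∈ interior I) {ε : ℝ} (hε : 0 < ε) :
    ∀ᶠ h in 𝓝[>] (0 : ℝ), v ⬝ᵥ secondDividedDiffMatrix I f c (p - h) *ᵥ v
      ≤ v ⬝ᵥ secondDividedDiffMatrix I f c (p + h) *ᵥ v + ε := by
  have hfp : DifferentiableAt ℝ f p := (hasDerivAt_derivWithin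
    (hf.1.differentiableOn one_ne_zero) (mem_interior_iff_mem_nhds.1 hp)).differentiableAt
  have hlim := tendsto_dotProduct_mulVec (N := 0)
    (tendsto_secondDividedDiffMatrix_add_sub (I := I) c hfp) v v
  rw [zero_mulVec, dotProduct_zero] at hlim
  filter_upwards [hlim.eventually (lt_mem_nhds (neg_lt_zero.2 hε)), self_mem_nhdsWithin,
    (eventually_Icc_sub_add_subset (isOpen_interior.mem_nhds hp)).filter_mono nhdsWithin_le_nhds]
    with h hlt (hh : 0 < h) hI
  have hjump : 0 ≤ secondDividedDiff I f p p (p + h) - secondDividedDiff I f p p (p - h) := by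
    rw [secondDividedDiff_same_add_sub p hh.ne']
    exact div_nonneg (sub_nonneg.2 (two_mul_derivWithin_le_of_mem_classQ hf hh hI)) (sq_nonneg h)
  have hrankOne := (posSemidef_vecMulVec_self_star ((c ⁻¹' {p}).indicator (1 : Fin k → ℝ))).smul
    hjump |>.dotProduct_mulVec_nonneg v
  simp only [star_trivial] at hrankOne
  simp only [sub_mulVec, dotProduct_sub] at hlt
  linarith

lemma monotoneOn_dotProduct_secondDividedDiffMatrix [NeZero k] (hI : Convex ℝ I)
    (hf : f ∈ classQ (k + 1) I) {c : Fin k → ℝ} (hc : ∀ i, c i ∈ I) (v : Fin k → ℝ) :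
    MonotoneOn (fun x => v ⬝ᵥ secondDividedDiffMatrix I f c x *ᵥ v)
      (I \ Finset.univ.image c) := by
  have hne {x : ℝ} (hx : x ∉ (Finset.univ.image c : Set ℝ)) (i : Fin k) : x ≠ c i := by
    rintro rfl
    exact hx (Finset.mem_coe.2 (Finset.mem_image_of_mem c (Finset.mem_univ i)))
  refine monotoneOn_diff_finset_of_deriv_nonneg hI (G' := fun x => v ⬝ᵥ (of fun i j =>
      (x - c i)⁻¹ * (dividedDiff I f (c i) (c j) - dividedDiff I f (c i) x
        - dividedDiff I f x (c j) + dividedDiff I f x x) * (x - c j)⁻¹) *ᵥ v)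
    ?_ (fun x hx => ?_) (fun x hx => ?_)
    fun p _ hp ε hε => eventually_dotProduct_secondDividedDiffMatrix_le_add hf c v hp hε
  · refine continuousOn_dotProduct_mulVec (fun i j => ?_) v v
    refine (continuousOn_secondDividedDiff hf.1.continuousOn (c i) (c j)).mono
      fun x hx => ⟨hx.1, ?_⟩
    rintro (h | h) <;> exact hne hx.2 _ h
  · refine hasDerivAt_dotProduct_mulVec (fun i j => ?_) v v
    refine (hasDerivAt_secondDividedDiff (hasDerivAt_derivWithin
      (hf.1.differentiableOn one_ne_zero) (mem_interior_iff_mem_nhds.1 hx.1))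
      (hne hx.2 i) (hne hx.2 j)).congr_deriv ?_
    rw [of_apply, div_eq_mul_inv, mul_inv]
    ring
  · exact (posSemidef_of_mul_mul (posSemidef_of_mem_classQ hf hc (interior_subset hx.1))
      fun i => (x - c i)⁻¹).dotProduct_mulVec_nonneg v

end Monotonicity

section KrausMatrix

variable {k : ℕ} {α : EReal} {f : ℝ → ℝ}

lemma krausMatrix_eq_mul_secondDividedDiffMatrix {ι : Type*} {I : Set ℝ} {c : ι → ℝ} {x : ℝ}
    (hx : ∀ i, x ≠ c i) : krausMatrix I f c x =
      of fun i j => (x - c i) * secondDividedDiffMatrix I f c x i j * (x - c j) :=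
  Matrix.ext fun i j => interpolationError_eq_mul_secondDividedDiff I f (hx i) (hx j)

lemma tendsto_interpolationError_add_add (hα : 0 < α)
    (hf : ContDiffOn ℝ 1 f (halfOpenInterval α)) {s t : ℝ} (hs : s ∈ halfOpenInterval α)
    (ht : t ∈ halfOpenInterval α) (x : ℝ) :
    Tendsto (fun e => interpolationError (halfOpenInterval α) f (s + e) (t + e) x) (𝓝[>] 0)
      (𝓝 (interpolationError (halfOpenInterval α) f s t x)) := by
  have hlim {g : ℝ → ℝ} (hg : ContinuousOn g (halfOpenInterval α)) {t : ℝ}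
      (ht : t ∈ halfOpenInterval α) : Tendsto (fun e => g (t + e)) (𝓝[>] 0) (𝓝 (g t)) :=
    (hg t ht).tendsto.comp (tendsto_const_add_nhdsWithin_halfOpenInterval ht)
  have hdd : Tendsto (fun e => dividedDiff (halfOpenInterval α) f (s + e) (t + e)) (𝓝[>] 0)
      (𝓝 (dividedDiff (halfOpenInterval α) f s t)) := by
    rcases eq_or_ne s t with rfl | hst
    · simp only [dividedDiff_self]
      exact hlim (hf.continuousOn_derivWithin (uniqueDiffOn_halfOpenInterval hα) le_rfl) hs
    · simp only [dividedDiff, add_left_inj, if_neg hst, add_sub_add_right_eq_sub]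
      exact ((hlim hf.continuousOn hs).sub (hlim hf.continuousOn ht)).div_const _
  exact (tendsto_const_nhds.sub (hlim hf.continuousOn hs)).sub
    (hdd.mul (tendsto_const_nhds.sub (hlim continuousOn_id hs)))

variable [NeZero k]

lemma posSemidef_secondDividedDiffMatrix (hf : f ∈ classQ (k + 1) (halfOpenInterval α))
    (hmono : IsMatrixMonotoneOn k (halfOpenInterval α) (derivWithin f (halfOpenInterval α)))
    {c : Fin k → ℝ} (hc : ∀ i, c i ∈ halfOpenInterval α) (hc0 : ∀ i, 0 < c i)
    {x : ℝ} (hx : x ∈ halfOpenInterval α) (hxc : ∀ i, x ≠ c i) :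
    (secondDividedDiffMatrix (halfOpenInterval α) f c x).PosSemidef := by
  have hmem {y : ℝ} (hy : y ∈ halfOpenInterval α) (hyc : ∀ i, y ≠ c i) :
      y ∈ halfOpenInterval α \ Finset.univ.image c :=
    ⟨hy, by simpa using fun i => (hyc i).symm⟩
  refine PosSemidef.of_dotProduct_mulVec_nonneg ?_ fun v => ?_
  · exact IsHermitian.ext fun i j => secondDividedDiff_comm ..
  · calc 0 ≤ v ⬝ᵥ secondDividedDiffMatrix (halfOpenInterval α) f c 0 *ᵥ v :=
          (posSemidef_secondDividedDiffMatrix_zero hf.1 hmono hc hc0).dotProduct_mulVec_nonneg v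
      _ ≤ v ⬝ᵥ secondDividedDiffMatrix (halfOpenInterval α) f c x *ᵥ v :=
          monotoneOn_dotProduct_secondDividedDiffMatrix (convex_halfOpenInterval α) hf hc v
            (hmem (mem_halfOpenInterval_of_le hx le_rfl hx.1) fun i => (hc0 i).ne)
            (hmem hx hxc) hx.1

lemma posSemidef_krausMatrix (hα : 0 < α) (hf : f ∈ classQ (k + 1) (halfOpenInterval α))
    (hmono : IsMatrixMonotoneOn k (halfOpenInterval α) (derivWithin f (halfOpenInterval α)))
    {c : Fin k → ℝ} (hc : ∀ i, c i ∈ halfOpenInterval α) {x : ℝ} (hx : x ∈ halfOpenInterval α) :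
    (krausMatrix (halfOpenInterval α) f c x).PosSemidef := by
  have hI : ∀ᶠ e in 𝓝[>] (0 : ℝ), ∀ i, c i + e ∈ halfOpenInterval α :=
    eventually_all.2 fun i =>
      (tendsto_const_add_nhdsGT (c i)).eventually_mem (halfOpenInterval_mem_nhdsGT (hc i))
  have hne : ∀ᶠ e in 𝓝[>] (0 : ℝ), ∀ i, x ≠ c i + e := by
    refine eventually_all.2 fun i => ?_
    rcases le_or_gt x (c i) with hxc | hxc
    · filter_upwards [self_mem_nhdsWithin] with e he
      exact (hxc.trans_lt (lt_add_of_pos_right _ he)).ne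
    · filter_upwards [Ioo_mem_nhdsGT (sub_pos.2 hxc)] with e he
      exact (lt_sub_iff_add_lt'.1 he.2).ne'
  refine posSemidef_of_tendsto (l := 𝓝[>] (0 : ℝ))
    (M := fun e => krausMatrix (halfOpenInterval α) f (fun i => c i + e) x) ?_
    fun i j => tendsto_interpolationError_add_add hα hf.1 (hc i) (hc j) x
  filter_upwards [hI, hne, self_mem_nhdsWithin] with e heI hxe he
  rw [krausMatrix_eq_mul_secondDividedDiffMatrix hxe]
  exact posSemidef_of_mul_mul (posSemidef_secondDividedDiffMatrix hf hmono heI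
    (fun i => add_pos_of_nonneg_of_pos (hc i).1 he) hx hxe) _

end KrausMatrix

theorem mainTheorem3 (n : ℕ) (hn : 2 ≤ n) (α : EReal) (hα : 0 < α) (f : ℝ → ℝ)
    (hf : f ∈ classQ n (halfOpenInterval α))
    (hmono : IsMatrixMonotoneOn (n - 1) (halfOpenInterval α)
      (derivWithin f (halfOpenInterval α))) :
    IsMatrixConvexOn (n - 1) (halfOpenInterval α) f := by
  obtain ⟨k, rfl⟩ : ∃ k, n = k + 1 := ⟨n - 1, by omega⟩
  rw [Nat.add_sub_cancel] at hmono ⊢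
  have : NeZero k := ⟨by omega⟩
  exact isMatrixConvexOn_of_posSemidef_krausMatrix (convex_halfOpenInterval α)
    fun _ hc _ hx => posSemidef_krausMatrix hα hf hmono hc hx
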